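/- Let $\mathbb{T}=\mathbb{R}/\mathbb{Z}$ and let $|\cdot|$ be the distance to $0$ on $\mathbb{T}$. The discrepancy of a finite family of points $y_1,\dots,y_M$ of $\mathbb{T}$ (counted with multiplicity) is $\sup_A \bigl|\tfrac1M\#\{i : y_i\in A\}-|A|\bigr|$, the supremum over all intervals $A\subset\mathbb{T}$, where $|A|$ is the length of $A$. For a sequence $(x_n)_{n\ge1}$ in $\mathbb{T}$, let $D_N$ be the discrepancy of $x_1,\dots,x_N$. There is a universal constant $C>0$ such that the following hold. (1) Let $(x_n)$ be a sequence in $\mathbb{T}$, let $k,N\ge1$ be integers and let $\alpha,T,F$ be real numbers with $0\le\alpha\le k$ and $T>0$. Suppose that for all real $s$ with $0<s<T$ $$\frac{1}{N^{2k-\alpha}}\#\Bigl\{(a,b)\in(\{1,\dots,N\}^k)^2 : \{a_1,\dots,a_k\}\ne\{b_1,\dots,b_k\},\ \Bigl|\sum_{j=1}^k x_{a_j}-\sum_{j=1}^k x_{b_j}\Bigr|\le\frac{s}{N^\alpha}\Bigr\}\le 2s+F ,$$ where $\{a_1,\dots,a_k\}$ and $\{b_1,\dots,b_k\}$ are compared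 as sets. Then $$D_N\le C\left(\frac{T}{N^\alpha}+k\left(\frac{k!}{T\,N^{k-\alpha}}+\frac FT\right)^{\frac1{2k}}\right).$$ (2) (The case $k=1$, $\alpha=0$.) For every sequence $(x_n)$ in $\mathbb{T}$ and every $N\ge2$, let $G$ be the discrepancy of the $N^2-N$ differences $x_m-x_n$, $1\le m\ne n\le N$. Then for every $T>0$ $$D_N\le C\left(T+\frac1{\sqrt T}\Bigl(\frac1N+G\Bigr)^{1/2}\right),\qquad\text{and}\qquad D_N\le C\Bigl(\frac1N+G\Bigr)^{1/3}.$$ (3) (Vinogradov's bound.) For every sequence $(x_n)$ in $\mathbb{T}$ and every $N\ge1$, if $F$ denotes the discrepancy of all $N^2$ differences $x_m-x_n$, $1\le m,n\le N$, then $D_N\le C\,F^{1/3}$. -/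

import Mathlib

/-- An interval of the circle `ℝ / ℤ`: the image of an interval of the real line (of any kind:
open, closed, half-open, empty, a single point, or long enough to cover the whole circle). -/
def IsCircleInterval (A : Set UnitAddCircle) : Prop :=
  ∃ I : Set ℝ, I.OrdConnected ∧ A = (fun t : ℝ => (t : UnitAddCircle)) '' I

open Classical in
/-- The value at `A` of the normalized counting measure of the finite family of points
`y i`, `i ∈ S`, of the circle (the points are counted with multiplicity). -/
noncomputable def empiricalMass {ι : Type*} (S : Finset ι) (y : ι → UnitAddCircle)
    (A : Set UnitAddCircle) : ℝ :=
  ((S.filter fun i => y i ∈ A).card : ℝ) / (S.card : ℝ)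

/-- The discrepancy of the finite family of points `y i`, `i ∈ S`, of the circle:
the supremum of `|μ(A) - |A||` over all intervals `A`, where `μ` is the normalized counting
measure of the family and `|A|` is the length of `A`. -/
noncomputable def familyDiscrepancy {ι : Type*} (S : Finset ι) (y : ι → UnitAddCircle) : ℝ :=
  ⨆ A : {A : Set UnitAddCircle // IsCircleInterval A},
    |empiricalMass S y A.1 - MeasureTheory.volume.real A.1|

/-- The discrepancy `D_N` of the first `N` points `x_1, …, x_N` of a sequence on the circle. -/
noncomputable def seqDiscrepancy (x : ℕ → UnitAddCircle) (N : ℕ) : ℝ :=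
  familyDiscrepancy (Finset.Icc 1 N) x

/-- All `k`-tuples of indices in `{1, …, N}`. -/
def indexTuples (k N : ℕ) : Finset (Fin k → ℕ) :=
  Fintype.piFinset fun _ => Finset.Icc 1 N

open Classical in
/-- The number of pairs of `k`-tuples `(a, b)` with entries in `{1, …, N}`, with
`{a_1, …, a_k} ≠ {b_1, …, b_k}`, such that the `2k`-fold difference
`∑ x_{a_j} - ∑ x_{b_j}` is at distance at most `r` from `0` on the circle
(the norm on `UnitAddCircle` is the distance to the nearest integer). -/
noncomputable def correlationCount (x : ℕ → UnitAddCircle) (k N : ℕ) (r : ℝ) : ℕ :=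
  ((indexTuples k N ×ˢ indexTuples k N).filter fun p =>
    Set.range p.1 ≠ Set.range p.2 ∧ ‖(∑ j, x (p.1 j)) - ∑ j, x (p.2 j)‖ ≤ r).card

/-- The normalized count at rate `α`:
`N^{-(2k-α)} · #{(a, b) : {a_j} ≠ {b_j}, |∑ x_{a_j} - ∑ x_{b_j}| ≤ s / N^α}`. -/
noncomputable def correlationAtRate (x : ℕ → UnitAddCircle) (k N : ℕ) (α s : ℝ) : ℝ :=
  (correlationCount x k N (s / (N : ℝ) ^ α) : ℝ) / (N : ℝ) ^ (2 * (k : ℝ) - α)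

/-- The pairwise difference `x_m - x_n` attached to the pair of indices `(m, n)`. -/
def pairDifference (x : ℕ → UnitAddCircle) (p : ℕ × ℕ) : UnitAddCircle := x p.1 - x p.2

/-- The discrepancy of the `N ^ 2 - N` differences `x_m - x_n`, `1 ≤ m ≠ n ≤ N`. -/
noncomputable def offDiagDifferenceDiscrepancy (x : ℕ → UnitAddCircle) (N : ℕ) : ℝ :=
  familyDiscrepancy (Finset.Icc 1 N).offDiag (pairDifference x)

/-- The discrepancy of all `N ^ 2` differences `x_m - x_n`, `1 ≤ m, n ≤ N`. -/
noncomputable def differenceDiscrepancy (x : ℕ → UnitAddCircle) (N : ℕ) : ℝ :=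
  familyDiscrepancy (Finset.Icc 1 N ×ˢ Finset.Icc 1 N) (pairDifference x)

open Real

/-! Write `S_m` for the `m`-th exponential sum of `x_1, …, x_N`. Squeezing an interval between
trapezoids with slopes of width `r` bounds the discrepancy by `2r + ∑ (1/m) · absSinc r m · |S_m|/N`
(`familyDiscrepancy_le_of_sum_le`). The damping factor is kept rather than truncating as in
Erdős–Turán, because its square is the Fourier coefficient of a triangular kernel.

Hölder with exponents `2k/(2k-1)` and `2k` (`sum_one_div_mul_le`) reduces this to `∑ absSinc² ·
(|S_m|/N)^(2k)`. As `S_m^k` is the exponential sum of the `k`-fold sums of the points, this is a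
pair energy for the triangle, a quantity averaging the correlation counts over scales below `r`. The
main term `2s` cancels exactly against the mean of the kernel; only `F` and the pairs with equal
index sets survive (`sum_energy_le`).

For `k = 1` the discrepancy of the differences controls the counts; `T = Q^(1/3)` balances the two
terms, and zero differences on the diagonal give `1/N ≤ F` for Vinogradov's bound. -/

/-! ### Fourier series of trapezoids -/

theorem re_fourier_eq_cos (m : ℕ) (y : UnitAddCircle) :
    (fourier (m : ℤ) y).re = cos (2 * π * m * ‖y‖) := by
  induction y using QuotientAddGroup.induction_on with | H t =>
  change (fourier (m : ℤ) (t : UnitAddCircle)).re = cos (2 * π * m * ‖(t : UnitAddCircle)‖)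
  have h1 : 2 * π * m * |t - round t| = |2 * π * m * (t - round t)| := by
    rw [abs_mul, abs_of_nonneg (by positivity : (0 : ℝ) ≤ 2 * π * m)]
  have h2 : 2 * π * m * (t - round t) = 2 * π * m * t - ((m * round t : ℤ) : ℝ) * (2 * π) := by
    push_cast; ring
  rw [UnitAddCircle.norm_eq, h1, cos_abs, h2, cos_sub_int_mul_two_pi, fourier_coe_apply,
    show (2 * π * Complex.I * ((m : ℤ) : ℂ) * t / (1 : ℝ) : ℂ)
      = ((2 * π * m * t : ℝ) : ℂ) * Complex.I by push_cast; ring, Complex.exp_ofReal_mul_I_re]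

/-- The second Bernoulli polynomial on `[0, 1]`, extended evenly. Its corner at `0` is what builds
piecewise linear functions. -/
theorem hasSum_cos_div_sq {x : ℝ} (hx : |x| ≤ 1) :
    HasSum (fun m : ℕ => cos (2 * π * m * x) / (m : ℝ) ^ 2)
      (π ^ 2 * (x ^ 2 - |x| + 1 / 6)) := by
  have h := hasSum_one_div_nat_pow_mul_cos one_ne_zero (x := |x|) ⟨abs_nonneg x, hx⟩
  convert! h using 1
  · funext m
    rw [show 2 * π * m * |x| = |2 * π * m * x| by
      rw [abs_mul, abs_of_nonneg (by positivity : (0 : ℝ) ≤ 2 * π * m)], cos_abs]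
    simp [div_eq_inv_mul]
  · simp [Polynomial.bernoulli, Finset.sum_range_succ, bernoulli_eq_bernoulli'_of_ne_one,
      Polynomial.eval_monomial, Nat.factorial]
    ring

/-- The trapezoid of the variable `t`: equal to `1` for `|t| ≤ q`, to `0` for `p ≤ |t|`, and affine
in between. -/
noncomputable def trapezoid (p q t : ℝ) : ℝ := (p - q + |t - p| - |t - q|) / (2 * (p - q))

/-- Combining the Bernoulli series at `t ± q` and `t ± p` cancels `t²` and leaves only the corners.
The term `m = 0` is `0` by division by zero, which is why the mean `p + q` is subtracted on the
right. -/
theorem hasSum_trapezoid {p q : ℝ} (hq : 0 ≤ q) (hqp : q < p) (hp : p ≤ 1 / 2)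
    (y : UnitAddCircle) :
    HasSum (fun m : ℕ => 2 * sin (π * m * (p + q)) * sin (π * m * (p - q)) /
        (π ^ 2 * (m : ℝ) ^ 2 * (p - q)) * (fourier (m : ℤ) y).re)
      (trapezoid p q ‖y‖ - (p + q)) := by
  set t := ‖y‖ with ht
  have ht0 : 0 ≤ t := norm_nonneg y
  have ht1 : t ≤ 1 / 2 := by
    simpa using AddCircle.norm_le_half_period 1 one_ne_zero (x := y)
  have e1 := hasSum_cos_div_sq (x := t + q) (by rw [abs_le]; constructor <;> linarith)
  have e2 := hasSum_cos_div_sq (x := t - q) (by rw [abs_le]; constructor <;> linarith)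
  have e3 := hasSum_cos_div_sq (x := t + p) (by rw [abs_le]; constructor <;> linarith)
  have e4 := hasSum_cos_div_sq (x := t - p) (by rw [abs_le]; constructor <;> linarith)
  have e := (((e1.add e2).sub e3).sub e4).mul_left (1 / (2 * π ^ 2 * (p - q)))
  have hd : p - q ≠ 0 := by linarith
  convert! e using 1
  · funext m
    rw [re_fourier_eq_cos, ← ht]
    have c1 := cos_add (2 * π * m * t) (2 * π * m * q)
    have c2 := cos_sub (2 * π * m * t) (2 * π * m * q)
    have c3 := cos_add (2 * π * m * t) (2 * π * m * p)
    have c4 := cos_sub (2 * π * m * t) (2 * π * m * p)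
    have c5 := cos_add (π * m * (p + q)) (π * m * (p - q))
    have c6 := cos_sub (π * m * (p + q)) (π * m * (p - q))
    rw [← mul_add] at c1 c3 c5
    rw [← mul_sub] at c2 c4 c6
    rw [show π * m * (p + q + (p - q)) = 2 * π * m * p by ring] at c5
    rw [show π * m * (p + q - (p - q)) = 2 * π * m * q by ring] at c6
    rw [c1, c2, c3, c4,
      show 2 * sin (π * m * (p + q)) * sin (π * m * (p - q))
        = cos (2 * π * m * q) - cos (2 * π * m * p) by rw [c5, c6]; ring]
    rcases eq_or_ne (m : ℝ) 0 with hm | hm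
    · simp [hm]
    · field_simp
      ring
  · rw [abs_of_nonneg (add_nonneg ht0 hq), abs_of_nonneg (add_nonneg ht0 (hq.trans hqp.le))]
    unfold trapezoid
    field_simp
    ring

theorem trapezoid_of_le {p q t : ℝ} (hqp : q < p) (h : t ≤ q) : trapezoid p q t = 1 := by
  have : p - q ≠ 0 := by linarith
  rw [trapezoid, abs_of_nonpos (by linarith), abs_of_nonpos (by linarith)]
  field_simp
  ring

theorem trapezoid_of_ge {p q t : ℝ} (hqp : q < p) (h : p ≤ t) : trapezoid p q t = 0 := by
  rw [trapezoid, abs_of_nonneg (by linarith), abs_of_nonneg (by linarith)]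
  ring

theorem trapezoid_nonneg {p q : ℝ} (hqp : q < p) (t : ℝ) : 0 ≤ trapezoid p q t := by
  refine div_nonneg ?_ (by linarith)
  have := abs_sub_abs_le_abs_sub (t - q) (t - p)
  rw [show t - q - (t - p) = p - q by ring, abs_of_pos (sub_pos.2 hqp)] at this
  linarith

theorem trapezoid_le_one {p q : ℝ} (hqp : q < p) (t : ℝ) : trapezoid p q t ≤ 1 := by
  rw [trapezoid, div_le_one (by linarith)]
  have := abs_sub_abs_le_abs_sub (t - p) (t - q)
  rw [show t - p - (t - q) = -(p - q) by ring, abs_neg, abs_of_pos (sub_pos.2 hqp)] at this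
  linarith

theorem trapezoid_zero {r t : ℝ} (hr : 0 < r) (ht : 0 ≤ t) :
    trapezoid r 0 t = max 0 (r - t) / r := by
  rw [trapezoid, sub_zero, sub_zero, abs_of_nonneg ht]
  rcases le_total t r with h | h
  · rw [abs_of_nonpos (by linarith), max_eq_right (by linarith)]
    field_simp
    ring
  · rw [abs_of_nonneg (by linarith), max_eq_left (by linarith)]
    simp

/-! ### Pair energy of the triangular kernel -/

/-- The `m`-th Fourier coefficient of the normalized indicator of an interval of length `r`,
up to sign. -/
noncomputable def absSinc (r : ℝ) (m : ℕ) : ℝ := |sin (π * m * r)| / (π * m * r)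

theorem absSinc_nonneg {r : ℝ} (hr : 0 ≤ r) (m : ℕ) : 0 ≤ absSinc r m := by
  unfold absSinc; positivity

theorem absSinc_le_one {r : ℝ} (hr : 0 ≤ r) (m : ℕ) : absSinc r m ≤ 1 := by
  have h : (0 : ℝ) ≤ π * m * r := by positivity
  refine div_le_one_of_le₀ ?_ h
  simpa [abs_of_nonneg h] using abs_sin_le_abs (x := π * m * r)

theorem fourier_sub_apply (m : ℤ) (x y : UnitAddCircle) :
    fourier m (x - y) = fourier m x * (starRingEnd ℂ) (fourier m y) := by
  rw [← fourier_neg, fourier_apply, fourier_apply, fourier_apply, smul_sub, sub_eq_add_neg,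
    AddCircle.toCircle_add, neg_smul, Circle.coe_mul]

open Finset in
/-- The pair energy of a finite family of points of the circle for the triangular kernel. -/
theorem hasSum_pair_energy {ι : Type*} (S : Finset ι) (y : ι → UnitAddCircle) {r : ℝ} (hr : 0 < r)
    (hr2 : r ≤ 1 / 2) :
    HasSum (fun m : ℕ => 2 * absSinc r m ^ 2 * ‖∑ i ∈ S, fourier (m : ℤ) (y i)‖ ^ 2)
      (∑ p ∈ S ×ˢ S, max 0 (r - ‖y p.1 - y p.2‖) / r ^ 2 - (#S : ℝ) ^ 2) := by
  -- The triangle is the trapezoid with `q = 0`; both sines then coincide and the coefficients are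
  -- squares.
  have h := (hasSum_sum (s := S ×ˢ S) fun p _ =>
    hasSum_trapezoid le_rfl hr hr2 (y p.1 - y p.2)).mul_left (1 / r)
  convert! h using 1
  · funext m
    have hre : ‖∑ i ∈ S, fourier (m : ℤ) (y i)‖ ^ 2
        = ∑ p ∈ S ×ˢ S, (fourier (m : ℤ) (y p.1 - y p.2)).re := by
      rw [← Complex.normSq_eq_norm_sq, ← Complex.ofReal_re (Complex.normSq _),
        Complex.normSq_eq_conj_mul_self, mul_comm, map_sum, sum_mul_sum, ← sum_product',
        Complex.re_sum]
      refine sum_congr rfl fun p _ => ?_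
      rw [fourier_sub_apply]
    rw [← mul_sum, hre, ← mul_assoc]
    congr 1
    simp only [add_zero, sub_zero, absSinc, div_pow, sq_abs]
    rcases eq_or_ne (m : ℝ) 0 with hm | hm
    · simp [hm]
    · field_simp
  · rw [sum_sub_distrib, mul_sub, mul_sum]
    congr 1
    · refine sum_congr rfl fun p _ => ?_
      rw [trapezoid_zero hr (norm_nonneg _)]
      field_simp
    · simp [card_product]
      field_simp

/-! ### Circle intervals and elementary facts on discrepancy -/

theorem volumeReal_closedBall (c : UnitAddCircle) {h : ℝ} (hh : 0 ≤ h) :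
    MeasureTheory.volume.real (Metric.closedBall c h) = min 1 (2 * h) := by
  rw [MeasureTheory.Measure.real, AddCircle.volume_closedBall, ENNReal.toReal_ofReal]
  exact le_min zero_le_one (by linarith)

theorem volumeReal_ball (c : UnitAddCircle) {h : ℝ} (hh : 0 ≤ h) :
    MeasureTheory.volume.real (Metric.ball c h) = min 1 (2 * h) := by
  rw [← volumeReal_closedBall c hh]
  exact (MeasureTheory.measureReal_congr AddCircle.closedBall_ae_eq_ball).symm

theorem volumeReal_unitAddCircle_le_one (A : Set UnitAddCircle) :
    MeasureTheory.volume.real A ≤ 1 := by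
  have h := MeasureTheory.measureReal_mono (μ := MeasureTheory.volume) (Set.subset_univ A)
  simpa [MeasureTheory.Measure.real] using h

/-- Up to its boundary, a nonempty circle interval is a ball. -/
theorem IsCircleInterval.exists_ball {A : Set UnitAddCircle} (hA : IsCircleInterval A)
    (hne : A.Nonempty) :
    ∃ (c : UnitAddCircle) (h : ℝ), 0 ≤ h ∧ Metric.ball c h ⊆ A ∧ A ⊆ Metric.closedBall c h := by
  obtain ⟨I, hI, rfl⟩ := hA
  have hIne : I.Nonempty := Set.image_nonempty.1 hne
  -- An interval containing a full period covers the circle, as does any ball of radius `1`.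
  -- Unbounded intervals fall under this case.
  have hlong : (∃ s ∈ I, ∃ t ∈ I, s + 1 ≤ t) → ∃ (c : UnitAddCircle) (h : ℝ), 0 ≤ h ∧
      Metric.ball c h ⊆ (fun t : ℝ => (t : UnitAddCircle)) '' I ∧
      (fun t : ℝ => (t : UnitAddCircle)) '' I ⊆ Metric.closedBall c h := by
    rintro ⟨s, hs, t, ht, hst⟩
    refine ⟨0, 1, zero_le_one, ?_, fun y _ => ?_⟩
    · refine (Set.subset_univ _).trans ?_
      rw [← AddCircle.coe_image_Icc_eq (1 : ℝ) s]
      exact Set.image_mono ((Set.Icc_subset_Icc_right hst).trans (hI.out hs ht))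
    · rw [mem_closedBall_zero_iff]
      have := AddCircle.norm_le_half_period 1 one_ne_zero (x := y)
      norm_num at this
      linarith
  obtain ⟨t₀, ht₀⟩ := hIne
  by_cases hb : BddBelow I
  swap
  · obtain ⟨s, hs, hst⟩ := not_bddBelow_iff.1 hb (t₀ - 1)
    exact hlong ⟨s, hs, t₀, ht₀, by linarith⟩
  by_cases ha : BddAbove I
  swap
  · obtain ⟨s, hs, hst⟩ := not_bddAbove_iff.1 ha (t₀ + 1)
    exact hlong ⟨t₀, ht₀, s, hs, hst.le⟩
  have h1 := IsConnected.Ioo_csInf_csSup_subset ⟨⟨t₀, ht₀⟩, hI.isPreconnected⟩ hb ha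
  have h2 := subset_Icc_csInf_csSup hb ha
  set a := sInf I
  set b := sSup I
  have hab : a ≤ b := (h2 ht₀).1.trans (h2 ht₀).2
  refine ⟨((a + b) / 2 : ℝ), (b - a) / 2, by linarith, fun y hy => ?_, ?_⟩
  · induction y using QuotientAddGroup.induction_on with | H t =>
    change (t : UnitAddCircle) ∈ _ at hy
    rw [Metric.mem_ball, dist_eq_norm, ← AddCircle.coe_sub, UnitAddCircle.norm_eq, abs_lt] at hy
    refine ⟨t - round (t - (a + b) / 2), h1 ⟨by linarith, by linarith⟩, ?_⟩
    have : ((round (t - (a + b) / 2) : ℝ) : UnitAddCircle) = 0 :=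
      (AddCircle.coe_eq_zero_iff 1).2 ⟨round (t - (a + b) / 2), by simp⟩
    simp only [AddCircle.coe_sub, this, sub_zero]
  · rintro _ ⟨t, ht, rfl⟩
    have := h2 ht
    rw [Metric.mem_closedBall, dist_eq_norm, ← AddCircle.coe_sub, UnitAddCircle.norm_eq]
    refine (round_le _ 0).trans ?_
    rw [Int.cast_zero, sub_zero, abs_le]
    constructor <;> linarith [this.1, this.2]

theorem empiricalMass_nonneg {ι : Type*} (S : Finset ι) (y : ι → UnitAddCircle)
    (A : Set UnitAddCircle) : 0 ≤ empiricalMass S y A := by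
  unfold empiricalMass; positivity

theorem empiricalMass_le_one {ι : Type*} (S : Finset ι) (y : ι → UnitAddCircle)
    (A : Set UnitAddCircle) : empiricalMass S y A ≤ 1 := by
  classical
  exact div_le_one_of_le₀ (mod_cast Finset.card_filter_le _ _) (Nat.cast_nonneg _)

theorem abs_empiricalMass_sub_volume_le_one {ι : Type*} (S : Finset ι) (y : ι → UnitAddCircle)
    (A : Set UnitAddCircle) : |empiricalMass S y A - MeasureTheory.volume.real A| ≤ 1 := by
  have h1 := empiricalMass_nonneg S y A
  have h2 := empiricalMass_le_one S y A
  have h3 := volumeReal_unitAddCircle_le_one A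
  have h4 : 0 ≤ MeasureTheory.volume.real A := MeasureTheory.measureReal_nonneg
  rw [abs_le]
  constructor <;> linarith

instance : Nonempty {A : Set UnitAddCircle // IsCircleInterval A} :=
  ⟨⟨∅, ∅, Set.ordConnected_empty, by simp⟩⟩

theorem familyDiscrepancy_le_one {ι : Type*} (S : Finset ι) (y : ι → UnitAddCircle) :
    familyDiscrepancy S y ≤ 1 :=
  ciSup_le fun A => abs_empiricalMass_sub_volume_le_one S y A.1

theorem le_familyDiscrepancy {ι : Type*} (S : Finset ι) (y : ι → UnitAddCircle)
    {A : Set UnitAddCircle} (hA : IsCircleInterval A) :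
    |empiricalMass S y A - MeasureTheory.volume.real A| ≤ familyDiscrepancy S y :=
  le_ciSup (f := fun A : {A : Set UnitAddCircle // IsCircleInterval A} =>
      |empiricalMass S y A.1 - MeasureTheory.volume.real A.1|)
    ⟨1, by rintro _ ⟨A, rfl⟩; exact abs_empiricalMass_sub_volume_le_one S y A.1⟩ ⟨A, hA⟩

theorem familyDiscrepancy_nonneg {ι : Type*} (S : Finset ι) (y : ι → UnitAddCircle) :
    0 ≤ familyDiscrepancy S y :=
  Real.iSup_nonneg fun _ => abs_nonneg _

/-! ### Smoothing: discrepancy and exponential sums -/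

open Finset in
/-- A smoothed indicator function integrates almost correctly against the family. -/
theorem abs_average_trapezoid_sub_le {ι : Type*} {S : Finset ι} (hS : S.Nonempty)
    (x : ι → UnitAddCircle) {r B : ℝ} (hr : 0 < r)
    (hB : ∀ M, ∑ m ∈ range M, 1 / (m : ℝ) *
      (absSinc r m * (‖∑ i ∈ S, fourier (m : ℤ) (x i)‖ / #S)) ≤ B)
    {q : ℝ} (hq : 0 ≤ q) (hqr : q + r ≤ 1 / 2) (c : UnitAddCircle) :
    |(∑ i ∈ S, trapezoid (q + r) q ‖x i - c‖) / #S - (2 * q + r)| ≤ B := by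
  have hn : (0 : ℝ) < #S := by exact_mod_cast hS.card_pos
  have h := ((hasSum_sum (s := S) fun i _ =>
    hasSum_trapezoid hq (by linarith : q < q + r) hqr (x i - c)).div_const (#S : ℝ))
  have e : (∑ i ∈ S, (trapezoid (q + r) q ‖x i - c‖ - (q + r + q))) / #S
      = (∑ i ∈ S, trapezoid (q + r) q ‖x i - c‖) / #S - (2 * q + r) := by
    rw [sum_sub_distrib, sum_const, nsmul_eq_mul, sub_div, mul_div_cancel_left₀ _ hn.ne']
    ring
  rw [e] at h
  refine le_of_tendsto h.tendsto_sum_nat.abs (Filter.Eventually.of_forall fun M => ?_)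
  refine (abs_sum_le_sum_abs _ _).trans ((sum_le_sum fun m _ => ?_).trans (hB M))
  rw [← mul_sum, ← Complex.re_sum, abs_div, Nat.abs_cast, abs_mul, add_sub_cancel_left, mul_div_assoc,
    ← mul_assoc]
  -- Translation by `c` only contributes a phase of modulus `1`.
  have hf : |(∑ i ∈ S, fourier (m : ℤ) (x i - c)).re| ≤ ‖∑ i ∈ S, fourier (m : ℤ) (x i)‖ := by
    refine (Complex.abs_re_le_norm _).trans ?_
    simp_rw [fourier_sub_apply, ← sum_mul]
    rw [norm_mul, RCLike.norm_conj, fourier_apply, Circle.norm_coe, mul_one]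
  refine mul_le_mul ?_ (by gcongr) (by positivity)
    (mul_nonneg (by positivity) (absSinc_nonneg hr.le m))
  rcases eq_or_ne m 0 with rfl | hm
  · simp
  have hm' : (0 : ℝ) < m := by positivity
  rw [abs_div, abs_mul, abs_mul, abs_two, abs_of_nonneg (by positivity : 0 ≤ π ^ 2 * (m : ℝ) ^ 2 * r),
    absSinc]
  have h1 := abs_sin_le_one (π * m * (q + r + q))
  have h2 := two_le_pi
  calc 2 * |sin (π * m * (q + r + q))| * |sin (π * m * r)| / (π ^ 2 * m ^ 2 * r)
      ≤ π * 1 * |sin (π * m * r)| / (π ^ 2 * m ^ 2 * r) := by gcongr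
    _ = _ := by field_simp

open Finset in
-- A ball of radius `h` is squeezed between the trapezoids of half-widths `(h - r, h)` and `(h, h +
-- r)`, whose means differ from `2h` by `r`. The larger loss `2r` covers the cases where one does
-- not fit: `h < r`, or `h + r > 1/2`.
theorem familyDiscrepancy_le_of_sum_le {ι : Type*} {S : Finset ι} (hS : S.Nonempty)
    (x : ι → UnitAddCircle) {r B : ℝ} (hr : 0 < r)
    (hB : ∀ M, ∑ m ∈ range M, 1 / (m : ℝ) *
      (absSinc r m * (‖∑ i ∈ S, fourier (m : ℤ) (x i)‖ / #S)) ≤ B) :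
    familyDiscrepancy S x ≤ 2 * r + B := by
  classical
  have hn : (0 : ℝ) < #S := by exact_mod_cast hS.card_pos
  have hB0 : 0 ≤ B := by simpa using hB 0
  have hmass : ∀ A : Set UnitAddCircle,
      empiricalMass S x A = (∑ i ∈ S, if x i ∈ A then (1 : ℝ) else 0) / #S := by
    intro A
    rw [empiricalMass, sum_boole]
  refine ciSup_le fun ⟨A, hA⟩ => ?_
  rcases A.eq_empty_or_nonempty with rfl | hne
  · simp [empiricalMass]; linarith
  obtain ⟨c, h, hh, hbA, hAb⟩ := hA.exists_ball hne
  have hvol : MeasureTheory.volume.real A = min 1 (2 * h) := le_antisymm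
    ((MeasureTheory.measureReal_mono hAb).trans_eq (volumeReal_closedBall c hh))
    ((volumeReal_ball c hh).symm.trans_le (MeasureTheory.measureReal_mono hbA))
  have m0 := empiricalMass_nonneg S x A
  have m1 := empiricalMass_le_one S x A
  simp only [hvol]
  rw [abs_le]
  constructor
  · rcases lt_or_ge h r with hr' | hr'
    · have := min_le_right 1 (2 * h)
      linarith
    rcases lt_or_ge (1 / 2) h with h2 | h2
    · have hA' : A = Set.univ := Set.eq_univ_of_univ_subset fun y _ => hbA <| by
        rw [Metric.mem_ball, dist_eq_norm]
        exact lt_of_le_of_lt (by simpa using AddCircle.norm_le_half_period 1 one_ne_zero) h2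
      have : empiricalMass S x A = 1 := by
        rw [hmass, hA']; simp [hn.ne']
      have := min_le_left 1 (2 * h)
      linarith
    have ht := abs_le.1 (abs_average_trapezoid_sub_le hS x hr hB (sub_nonneg.2 hr')
      (by linarith : h - r + r ≤ 1 / 2) c)
    have : (∑ i ∈ S, trapezoid (h - r + r) (h - r) ‖x i - c‖) / #S ≤ empiricalMass S x A := by
      rw [hmass]
      gcongr with i
      split_ifs with hi
      · exact trapezoid_le_one (by linarith) _
      · rw [trapezoid_of_ge (by linarith)]
        rw [sub_add_cancel, ← dist_eq_norm]
        exact not_lt.1 fun hlt => hi (hbA hlt)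
    have := min_le_right 1 (2 * h)
    linarith [ht.1]
  · rcases lt_or_ge (1 / 2) (h + r) with h2 | h2
    · have : 1 - 2 * r ≤ min 1 (2 * h) := le_min (by linarith) (by linarith)
      linarith
    have ht := abs_le.1 (abs_average_trapezoid_sub_le hS x hr hB hh h2 c)
    have : empiricalMass S x A ≤ (∑ i ∈ S, trapezoid (h + r) h ‖x i - c‖) / #S := by
      rw [hmass]
      gcongr with i
      split_ifs with hi
      · rw [trapezoid_of_le (by linarith)]
        rw [← dist_eq_norm]
        exact hAb hi
      · exact trapezoid_nonneg (by linarith) _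
    rw [min_eq_right (by linarith)]
    linarith [ht.2]

/-! ### Hölder's inequality with harmonic weights -/

theorem sum_range_one_div_rpow_le {s : ℝ} (hs : 0 < s) (hs1 : s ≤ 1) (M : ℕ) :
    ∑ m ∈ Finset.range M, (1 / (m : ℝ)) ^ (1 + s) ≤ 1 + 1 / s := by
  have hstep : ∀ M : ℕ, 1 ≤ M →
      ∑ m ∈ Finset.range (M + 1), (1 / (m : ℝ)) ^ (1 + s) ≤ 1 + 1 / s * (1 - (1 / (M : ℝ)) ^ s) := by
    intro M hM
    induction M, hM using Nat.le_induction with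
    | base =>
      have : (0 : ℝ) ^ (1 + s) = 0 := zero_rpow (by linarith)
      simp [Finset.sum_range_succ, this]
    | succ M hM ih =>
      rw [Finset.sum_range_succ]
      have hM' : (0 : ℝ) < M := by positivity
      set a : ℝ := 1 / ((M + 1 : ℕ) : ℝ) with ha
      have ha0 : 0 < a := by positivity
      have ha1 : a ≤ 1 := by
        rw [ha, div_le_one (by positivity)]; push_cast; linarith
      -- Bernoulli's inequality for `(1 - a)^s` replaces the comparison with an integral: it bounds
      -- `s * a^(1+s)` by the telescoping difference `M^(-s) - (M+1)^(-s)`.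
      have hbern := rpow_one_add_le_one_add_mul_self (s := -a) (by linarith) hs.le hs1
      have hMa : a = 1 / (M : ℝ) * (1 + -a) := by
        rw [ha]; push_cast; field_simp; ring
      have hpow : a ^ s = (1 / (M : ℝ)) ^ s * (1 + -a) ^ s := by
        rw [← mul_rpow (by positivity) (by linarith), ← hMa]
      have h1 : a ^ (1 + s) = a * a ^ s := by rw [rpow_add ha0, rpow_one]
      have hP : 0 ≤ (1 / (M : ℝ)) ^ s := by positivity
      have hle : a ^ s ≤ (1 / (M : ℝ)) ^ s * (1 + s * -a) := by
        rw [hpow]; gcongr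
      have hmono : a ^ s ≤ (1 / (M : ℝ)) ^ s := by nlinarith [mul_nonneg hP (mul_pos hs ha0).le]
      have h2 : s * (a * a ^ s) ≤ (1 / (M : ℝ)) ^ s - a ^ s := by
        nlinarith [mul_le_mul_of_nonneg_left hmono (mul_pos hs ha0).le]
      have h3 : a * a ^ s ≤ 1 / s * ((1 / (M : ℝ)) ^ s - a ^ s) := by
        rw [one_div, inv_mul_eq_div, le_div_iff₀ hs]; linarith
      rw [h1]
      linarith
  rcases Nat.eq_zero_or_pos M with rfl | hM
  · simp; positivity
  calc ∑ m ∈ Finset.range M, (1 / (m : ℝ)) ^ (1 + s)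
      ≤ ∑ m ∈ Finset.range (M + 1), (1 / (m : ℝ)) ^ (1 + s) :=
        Finset.sum_le_sum_of_subset_of_nonneg (Finset.range_subset_range.2 M.le_succ)
          fun _ _ _ => by positivity
    _ ≤ 1 + 1 / s * (1 - (1 / (M : ℝ)) ^ s) := hstep M hM
    _ ≤ 1 + 1 / s * 1 := by
        gcongr
        have : 0 ≤ (1 / (M : ℝ)) ^ s := by positivity
        linarith
    _ = _ := by ring

open Finset in
/-- Hölder's inequality with exponent `2k` against the weights `1 / m`. -/
theorem sum_one_div_mul_le {k : ℕ} (hk : 1 ≤ k) {a Z : ℕ → ℝ} (ha0 : ∀ m, 0 ≤ a m)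
    (ha1 : ∀ m, a m ≤ 1) (hZ : ∀ m, 0 ≤ Z m) {Q : ℝ} (M : ℕ)
    (hQ : ∑ m ∈ range M, a m ^ 2 * Z m ^ (2 * k) ≤ Q) :
    ∑ m ∈ range M, 1 / (m : ℝ) * (a m * Z m) ≤ 2 * k * Q ^ (1 / (2 * (k : ℝ))) := by
  have hk0 : (1 : ℝ) ≤ k := by exact_mod_cast hk
  have hd : (0 : ℝ) < 2 * k - 1 := by linarith
  -- Chosen so that `1 + s = 2k/(2k-1)` is conjugate to `2k` and `1 + 1/s = 2k`.
  set s : ℝ := 1 / (2 * k - 1) with hs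
  have hs0 : 0 < s := by positivity
  have hs1 : s ≤ 1 := by rw [hs, div_le_one hd]; linarith
  have hpq : (1 + s).HolderConjugate (2 * k) := by
    rw [Real.holderConjugate_iff]
    refine ⟨by linarith, ?_⟩
    rw [hs]
    field_simp
    ring
  -- Since `a ≤ 1`, the factor `a` may be enlarged to `a^(1/k)`, whose `2k`-th power is the required
  -- `a²`.
  have h := inner_le_Lp_mul_Lq_of_nonneg (range M) hpq (f := fun m : ℕ => 1 / (m : ℝ))
    (g := fun m => a m ^ (1 / (k : ℝ)) * Z m) (fun _ _ => by positivity)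
    (fun m _ => mul_nonneg (rpow_nonneg (ha0 m) _) (hZ m))
  have hpow : ∀ m, (a m ^ (1 / (k : ℝ)) * Z m) ^ (2 * (k : ℝ)) = a m ^ 2 * Z m ^ (2 * k) := by
    intro m
    rw [mul_rpow (rpow_nonneg (ha0 m) _) (hZ m), ← rpow_mul (ha0 m),
      show 1 / (k : ℝ) * (2 * k) = (2 : ℕ) by push_cast; field_simp, rpow_natCast,
      ← rpow_natCast (Z m) (2 * k)]
    push_cast
    rfl
  simp only [hpow] at h
  have hroot : (∑ m ∈ range M, (1 / (m : ℝ)) ^ (1 + s)) ^ (1 / (1 + s)) ≤ 2 * k := by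
    calc (∑ m ∈ range M, (1 / (m : ℝ)) ^ (1 + s)) ^ (1 / (1 + s))
        ≤ (2 * (k : ℝ)) ^ (1 / (1 + s)) := by
          gcongr
          refine (sum_range_one_div_rpow_le hs0 hs1 M).trans_eq ?_
          rw [hs]; field_simp; ring
      _ ≤ (2 * (k : ℝ)) ^ (1 : ℝ) := by
          gcongr
          · linarith
          · rw [div_le_one (by linarith)]; linarith
      _ = _ := rpow_one _
  have hnn : 0 ≤ ∑ m ∈ range M, a m ^ 2 * Z m ^ (2 * k) :=
    sum_nonneg fun m _ => mul_nonneg (sq_nonneg _) (pow_nonneg (hZ m) _)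
  calc ∑ m ∈ range M, 1 / (m : ℝ) * (a m * Z m)
      ≤ ∑ m ∈ range M, 1 / (m : ℝ) * (a m ^ (1 / (k : ℝ)) * Z m) := by
        gcongr with m
        · exact hZ m
        · exact self_le_rpow_of_le_one (ha0 m) (ha1 m) (by rw [div_le_one] <;> linarith)
    _ ≤ _ := h
    _ ≤ _ := by gcongr

/-! ### Correlations of `k`-fold sums -/

open Finset in
theorem sum_indexTuples_fourier (x : ℕ → UnitAddCircle) (k N : ℕ) (m : ℤ) :
    ∑ a ∈ indexTuples k N, fourier m (∑ j, x (a j)) = (∑ n ∈ Icc 1 N, fourier m (x n)) ^ k := by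
  have hprod : ∀ a : Fin k → ℕ, fourier m (∑ j, x (a j)) = ∏ j, fourier m (x (a j)) := by
    intro a
    have : ∀ s : Finset (Fin k), fourier m (∑ j ∈ s, x (a j)) = ∏ j ∈ s, fourier m (x (a j)) := by
      intro s
      induction s using Finset.cons_induction with
      | empty => simp
      | cons i s hi ih =>
        rw [sum_cons, prod_cons, ← ih, fourier_apply, fourier_apply, fourier_apply, smul_add,
          AddCircle.toCircle_add, Circle.coe_mul]
    exact this univ
  simp_rw [hprod]
  exact (prod_univ_sum (fun _ : Fin k => Icc 1 N) fun _ n => fourier m (x n)).symm.trans (by simp)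

theorem card_indexTuples (k N : ℕ) : (indexTuples k N).card = N ^ k := by
  simp [indexTuples]

open Finset Classical in
-- Equal ranges force `b = a ∘ σ` for some self-map `σ` of `Fin k`. It need not be a permutation
-- because entries may repeat, hence `k^k`.
theorem card_filter_range_eq_le (k N : ℕ) :
    #{p ∈ indexTuples k N ×ˢ indexTuples k N | Set.range p.1 = Set.range p.2} ≤ N ^ k * k ^ k := by
  have hsub : {p ∈ indexTuples k N ×ˢ indexTuples k N | Set.range p.1 = Set.range p.2}
      ⊆ (indexTuples k N ×ˢ (univ : Finset (Fin k → Fin k))).image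
        fun z => (z.1, z.1 ∘ z.2) := by
    rintro ⟨a, b⟩ hp
    simp only [mem_filter, mem_product] at hp
    have : ∀ j, ∃ i, a i = b j := fun j => by
      have : b j ∈ Set.range a := hp.2 ▸ Set.mem_range_self j
      exact this
    choose σ hσ using this
    rw [mem_image]
    exact ⟨(a, σ), by simp [hp.1.1], by simp [Function.comp_def, hσ]⟩
  refine (card_le_card hsub).trans (card_image_le.trans ?_)
  simp [card_product, card_indexTuples]

open Finset MeasureTheory in
-- Layer cake: `max 0 (r - d)` is the integral over `0 < u ≤ r` of the indicator of `d ≤ u`, so the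
-- counting bound can be integrated in `u`.
theorem sum_max_sub_le_of_card_le {ι : Type*} (P : Finset ι) {d : ι → ℝ} (hd : ∀ i, 0 ≤ d i)
    {r A B : ℝ} (hr : 0 < r)
    (h : ∀ u, 0 < u → u < r → (#{i ∈ P | d i ≤ u} : ℝ) ≤ 2 * A * u + B) :
    ∑ i ∈ P, max 0 (r - d i) ≤ A * r ^ 2 + B * r := by
  have hint : ∀ i, IntegrableOn ((Set.Ici (d i)).indicator fun _ => (1 : ℝ)) (Set.Ioc 0 r) :=
    fun i => (integrable_const (1 : ℝ)).indicator measurableSet_Ici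
  have h1 : ∀ i, max 0 (r - d i)
      ≤ ∫ u in Set.Ioc 0 r, (Set.Ici (d i)).indicator (fun _ => (1 : ℝ)) u := by
    intro i
    rw [setIntegral_indicator measurableSet_Ici, setIntegral_const, smul_eq_mul, mul_one]
    refine max_le measureReal_nonneg ?_
    calc r - d i ≤ max (r - d i) 0 := le_max_left _ _
      _ = volume.real (Set.Ioc (d i) r) := by rw [Real.volume_real_Ioc]
      _ ≤ volume.real (Set.Ioc 0 r ∩ Set.Ici (d i)) := measureReal_mono
        (fun u hu => ⟨⟨(hd i).trans_lt hu.1, hu.2⟩, hu.1.le⟩)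
        ((measure_mono Set.inter_subset_left).trans_lt measure_Ioc_lt_top).ne
  calc ∑ i ∈ P, max 0 (r - d i)
      ≤ ∑ i ∈ P, ∫ u in Set.Ioc 0 r, (Set.Ici (d i)).indicator (fun _ => (1 : ℝ)) u :=
        sum_le_sum fun i _ => h1 i
    _ = ∫ u in Set.Ioc 0 r, ∑ i ∈ P, (Set.Ici (d i)).indicator (fun _ => (1 : ℝ)) u :=
        (integral_finsetSum _ fun i _ => hint i).symm
    _ = ∫ u in Set.Ioo 0 r, ∑ i ∈ P, (Set.Ici (d i)).indicator (fun _ => (1 : ℝ)) u :=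
        integral_Ioc_eq_integral_Ioo
    _ ≤ ∫ u in Set.Ioo 0 r, (2 * A * u + B) := by
        refine setIntegral_mono_on ?_ ?_ measurableSet_Ioo fun u hu => ?_
        · exact integrable_finsetSum _ fun i _ => (hint i).mono_set Set.Ioo_subset_Ioc_self
        · exact (Continuous.integrableOn_Icc (by fun_prop)).mono_set Set.Ioo_subset_Icc_self
        · refine le_trans (le_of_eq ?_) (h u hu.1 hu.2)
          rw [← sum_boole]
          rfl
    _ = ∫ u in (0 : ℝ)..r, (2 * A * u + B) := by
        rw [intervalIntegral.integral_of_le hr.le, integral_Ioc_eq_integral_Ioo]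
    _ = _ := by
        rw [intervalIntegral.integral_add (Continuous.intervalIntegrable (by fun_prop) _ _)
            (Continuous.intervalIntegrable (by fun_prop) _ _),
          intervalIntegral.integral_const_mul, integral_id, intervalIntegral.integral_const]
        simp
        ring

open Finset Classical in
-- Integrating `2u` up to `r` gives `r²`, so after division by `r²` the main term is exactly the
-- `N^(2k)` subtracted in the pair energy.
theorem sum_energy_le {x : ℕ → UnitAddCircle} {k N : ℕ} (hk : 1 ≤ k) (hN : 1 ≤ N) {r F : ℝ}
    (hr : 0 < r) (hr2 : r ≤ 1 / 2) (hF : 0 ≤ F)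
    (h : ∀ u, 0 < u → u < r → (correlationCount x k N u : ℝ) ≤ N ^ (2 * k) * (2 * u + F)) (M : ℕ) :
    ∑ m ∈ range M, absSinc r m ^ 2 *
        (‖∑ n ∈ Icc 1 N, fourier (m : ℤ) (x n)‖ / N) ^ (2 * k)
      ≤ exp k * (k.factorial / (r * N ^ k) + F / r) := by
  have hN' : (0 : ℝ) < N := by exact_mod_cast hN
  set y : (Fin k → ℕ) → UnitAddCircle := fun a => ∑ j, x (a j) with hy
  have hsum := hasSum_pair_energy (indexTuples k N) y hr hr2
  have hpart := sum_le_hasSum (range M) (fun m _ => by positivity) hsum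
  have hcount := sum_max_sub_le_of_card_le
    {p ∈ indexTuples k N ×ˢ indexTuples k N | Set.range p.1 ≠ Set.range p.2}
    (d := fun p => ‖y p.1 - y p.2‖) (A := N ^ (2 * k)) (B := N ^ (2 * k) * F)
    (fun _ => norm_nonneg _) hr (fun u hu hur => by
      rw [filter_filter]
      refine (h u hu hur).trans_eq (by ring))
  have hdiag : ∑ p ∈ indexTuples k N ×ˢ indexTuples k N with Set.range p.1 = Set.range p.2,
      max 0 (r - ‖y p.1 - y p.2‖) ≤ N ^ k * k ^ k * r := by
    refine (sum_le_card_nsmul _ _ r fun p _ => max_le hr.le (by simp)).trans ?_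
    rw [nsmul_eq_mul]
    gcongr
    exact_mod_cast card_filter_range_eq_le k N
  have hsplit := sum_filter_add_sum_filter_not (indexTuples k N ×ˢ indexTuples k N)
    (fun p => Set.range p.1 = Set.range p.2) (fun p => max 0 (r - ‖y p.1 - y p.2‖))
  have htot : ∑ p ∈ indexTuples k N ×ˢ indexTuples k N, max 0 (r - ‖y p.1 - y p.2‖)
      ≤ N ^ k * k ^ k * r + (N ^ (2 * k) * r ^ 2 + N ^ (2 * k) * F * r) := by
    rw [← hsplit]
    exact add_le_add hdiag hcount
  -- One term of the exponential series; the factor `exp k` shrinks to `√e` under the later `2k`-th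
  -- root.
  have hfac : (k : ℝ) ^ k ≤ exp k * k.factorial := by
    have := Real.pow_div_factorial_le_exp (k : ℝ) (Nat.cast_nonneg k) k
    rwa [div_le_iff₀ (by positivity)] at this
  have hexp : 1 ≤ exp (k : ℝ) := one_le_exp (Nat.cast_nonneg k)
  have hterm : ∀ m : ℕ, absSinc r m ^ 2 *
        (‖∑ n ∈ Icc 1 N, fourier (m : ℤ) (x n)‖ / N) ^ (2 * k)
      = (2 * (N : ℝ) ^ (2 * k))⁻¹ *
        (2 * absSinc r m ^ 2 * ‖∑ a ∈ indexTuples k N, fourier (m : ℤ) (y a)‖ ^ 2) := by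
    intro m
    rw [hy, sum_indexTuples_fourier, norm_pow, div_pow, ← pow_mul, mul_comm k 2]
    field_simp
  simp_rw [hterm]
  rw [← mul_sum, inv_mul_le_iff₀ (by positivity)]
  rw [← sum_div, card_indexTuples] at hpart
  refine hpart.trans ?_
  have hbound : (∑ p ∈ indexTuples k N ×ˢ indexTuples k N, max 0 (r - ‖y p.1 - y p.2‖)) / r ^ 2
      - ((N ^ k : ℕ) : ℝ) ^ 2 ≤ N ^ (2 * k) * (k ^ k / (r * N ^ k) + F / r) := by
    rw [sub_le_iff_le_add, div_le_iff₀ (by positivity)]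
    refine htot.trans_eq ?_
    push_cast
    rw [pow_mul', sq]
    field_simp
    ring
  refine hbound.trans ?_
  have h1 : (k : ℝ) ^ k / (r * N ^ k) + F / r
      ≤ exp k * (k.factorial / (r * N ^ k) + F / r) := by
    rw [mul_add, ← mul_div_assoc]
    gcongr
    exact le_mul_of_one_le_left (by positivity) hexp
  have h2 : 0 ≤ (k : ℝ) ^ k / (r * N ^ k) + F / r := by positivity
  have h3 : (0 : ℝ) < N ^ (2 * k) := by positivity
  nlinarith [mul_le_mul_of_nonneg_left h1 h3.le, mul_nonneg h3.le (h2.trans h1)]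

theorem seqDiscrepancy_le_of_correlationCount_le {x : ℕ → UnitAddCircle} {k N : ℕ} (hk : 1 ≤ k)
    (hN : 1 ≤ N) {r F : ℝ} (hr : 0 < r) (hF : 0 ≤ F)
    (h : ∀ u, 0 < u → u < r → (correlationCount x k N u : ℝ) ≤ N ^ (2 * k) * (2 * u + F)) :
    seqDiscrepancy x N ≤
      4 * (r + k * (k.factorial / (r * N ^ k) + F / r) ^ (1 / (2 * (k : ℝ)))) := by
  set Q := (k.factorial : ℝ) / (r * N ^ k) + F / r
  have hQ : 0 ≤ Q := by positivity
  have hP : 0 ≤ k * Q ^ (1 / (2 * (k : ℝ))) := by positivity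
  rcases lt_or_ge (1 / 2) r with hr2 | hr2
  · refine (familyDiscrepancy_le_one _ _).trans ?_
    linarith
  have hk' : (0 : ℝ) < k := by exact_mod_cast hk
  have hD := familyDiscrepancy_le_of_sum_le (S := Finset.Icc 1 N) ⟨1, by simp [hN]⟩ x hr
    (B := 2 * k * (exp k * Q) ^ (1 / (2 * (k : ℝ)))) fun M => by
      rw [Nat.card_Icc, add_tsub_cancel_right]
      exact sum_one_div_mul_le hk (fun m => absSinc_nonneg hr.le m)
        (fun m => absSinc_le_one hr.le m) (fun m => by positivity) M
        (sum_energy_le hk hN hr hr2 hF h M)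
  have he : exp (k : ℝ) ^ (1 / (2 * (k : ℝ))) ≤ 2 := by
    rw [← exp_mul, show (k : ℝ) * (1 / (2 * k)) = 1 / 2 by field_simp]
    have h1 : exp (1 / 2 : ℝ) * exp (1 / 2) = exp 1 := by rw [← exp_add]; norm_num
    have h2 := exp_one_lt_d9
    nlinarith [exp_pos (1 / 2 : ℝ)]
  rw [mul_rpow (exp_pos _).le hQ] at hD
  refine hD.trans ?_
  have : exp (k : ℝ) ^ (1 / (2 * (k : ℝ))) * Q ^ (1 / (2 * (k : ℝ)))
      ≤ 2 * Q ^ (1 / (2 * (k : ℝ))) := by gcongr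
  nlinarith

theorem seqDiscrepancy_le_of_correlationAtRate_le {x : ℕ → UnitAddCircle} {k N : ℕ} {α T F : ℝ}
    (hk : 1 ≤ k) (hN : 1 ≤ N) (hT : 0 < T)
    (h : ∀ s : ℝ, 0 < s → s < T → correlationAtRate x k N α s ≤ 2 * s + F) :
    seqDiscrepancy x N ≤
      4 * (T / (N : ℝ) ^ α +
        (k : ℝ) * ((k.factorial : ℝ) / (T * (N : ℝ) ^ ((k : ℝ) - α)) + F / T) ^
          (1 / (2 * (k : ℝ)))) := by
  have hN' : (0 : ℝ) < N := by exact_mod_cast hN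
  have hNα : (0 : ℝ) < (N : ℝ) ^ α := by positivity
  -- Counts are nonnegative, so letting `s → 0` in the hypothesis forces `F ≥ 0`.
  have hF : 0 ≤ F := by
    by_contra! hF
    obtain ⟨s, hs0, hs⟩ := exists_between (lt_min hT (by linarith : 0 < -F / 2))
    have h1 := h s hs0 (hs.trans_le (min_le_left _ _))
    have h2 := hs.trans_le (min_le_right _ _)
    have : 0 ≤ correlationAtRate x k N α s := by unfold correlationAtRate; positivity
    linarith
  have hpow : (N : ℝ) ^ (2 * (k : ℝ) - α) = N ^ (2 * k) / (N : ℝ) ^ α := by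
    rw [rpow_sub hN', ← rpow_natCast (N : ℝ) (2 * k)]; push_cast; rfl
  have hmain := seqDiscrepancy_le_of_correlationCount_le (x := x) hk hN
    (r := T / (N : ℝ) ^ α) (F := F / (N : ℝ) ^ α) (by positivity) (by positivity)
    fun u hu hur => by
      have := h (u * (N : ℝ) ^ α) (by positivity) (by rwa [lt_div_iff₀ hNα] at hur)
      rw [correlationAtRate, mul_div_cancel_right₀ _ hNα.ne', hpow,
        div_le_iff₀ (by positivity)] at this
      refine this.trans_eq ?_
      field_simp
  convert hmain using 5
  · rw [rpow_sub hN', rpow_natCast]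
    field_simp

/-! ### Differences: the case `k = 1` and Vinogradov's bound -/

theorem offDiag_subset_product {ι : Type*} [DecidableEq ι] (s : Finset ι) :
    s.offDiag ⊆ s ×ˢ s := fun _ hp =>
  have h := Finset.mem_offDiag.1 hp
  Finset.mem_product.2 ⟨h.1, h.2.1⟩

open Finset Classical in
theorem correlationCount_one (x : ℕ → UnitAddCircle) (N : ℕ) (u : ℝ) :
    correlationCount x 1 N u = #{p ∈ (Icc 1 N).offDiag | ‖pairDifference x p‖ ≤ u} := by
  refine card_bij (fun p _ => (p.1 0, p.2 0)) ?_ ?_ ?_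
  · rintro ⟨a, b⟩ hp
    have hconst : ∀ a : Fin 1 → ℕ, Set.range a = {a 0} := fun a => Set.range_unique
    rw [mem_filter, mem_offDiag]
    rw [mem_filter, mem_product] at hp
    simp only [indexTuples, Fintype.mem_piFinset, hconst, univ_unique, sum_singleton] at hp
    refine ⟨⟨hp.1.1 0, hp.1.2 0, fun hab => hp.2.1 (congrArg _ hab)⟩, hp.2.2⟩
  · rintro ⟨a, b⟩ _ ⟨a', b'⟩ _ h
    simp only [Prod.mk.injEq] at h ⊢
    constructor <;> funext i <;> fin_cases i
    exacts [h.1, h.2]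
  · rintro ⟨m, n⟩ hp
    rw [mem_filter, mem_offDiag] at hp
    refine ⟨(fun _ => m, fun _ => n), ?_, rfl⟩
    rw [mem_filter, mem_product]
    simpa [indexTuples, pairDifference, and_assoc] using hp

theorem isCircleInterval_closedBall_zero (u : ℝ) :
    IsCircleInterval (Metric.closedBall (0 : UnitAddCircle) u) := by
  refine ⟨Set.Icc (-u) u, Set.ordConnected_Icc, Set.Subset.antisymm (fun y hy => ?_) ?_⟩
  · induction y using QuotientAddGroup.induction_on with | H t =>
    change (t : UnitAddCircle) ∈ _ at hy
    rw [mem_closedBall_zero_iff, UnitAddCircle.norm_eq] at hy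
    refine ⟨t - round t, abs_le.1 hy, ?_⟩
    have : ((round t : ℝ) : UnitAddCircle) = 0 :=
      (AddCircle.coe_eq_zero_iff 1).2 ⟨round t, by simp⟩
    simp only [AddCircle.coe_sub, this, sub_zero]
  · rintro _ ⟨t, ht, rfl⟩
    rw [mem_closedBall_zero_iff, UnitAddCircle.norm_eq]
    refine (round_le _ 0).trans ?_
    rw [Int.cast_zero, sub_zero, abs_le]
    exact ht

open Finset Classical in
theorem card_filter_norm_le {ι : Type*} (S : Finset ι) (y : ι → UnitAddCircle) {u : ℝ}
    (hu : 0 ≤ u) : (#{i ∈ S | ‖y i‖ ≤ u} : ℝ) ≤ #S * (2 * u + familyDiscrepancy S y) := by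
  rcases S.eq_empty_or_nonempty with rfl | hS
  · simp
  have hn : (0 : ℝ) < #S := by exact_mod_cast hS.card_pos
  have h := (abs_le.1 (le_familyDiscrepancy S y (isCircleInterval_closedBall_zero u))).2
  rw [volumeReal_closedBall _ hu, empiricalMass] at h
  simp only [mem_closedBall_zero_iff] at h
  have := min_le_right 1 (2 * u)
  rw [mul_comm, ← div_le_iff₀ hn]
  linarith

/-- The bound for the pair correlations of the family of differences over any set of pairs that
lies between the off-diagonal pairs and all pairs. -/
theorem seqDiscrepancy_le_of_offDiag_subset {x : ℕ → UnitAddCircle} {N : ℕ} (hN : 1 ≤ N)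
    {S : Finset (ℕ × ℕ)} (hS : (Finset.Icc 1 N).offDiag ⊆ S)
    (hS' : S ⊆ Finset.Icc 1 N ×ˢ Finset.Icc 1 N) {T : ℝ} (hT : 0 < T) :
    seqDiscrepancy x N ≤ 4 * (T + 1 / √T *
      (1 / (N : ℝ) + familyDiscrepancy S (pairDifference x)) ^ (1 / 2 : ℝ)) := by
  classical
  set G := familyDiscrepancy S (pairDifference x)
  have hG : 0 ≤ G := familyDiscrepancy_nonneg _ _
  have hcard : S.card ≤ N ^ 2 := by
    have := Finset.card_le_card hS'
    rwa [Finset.card_product, Nat.card_Icc, add_tsub_cancel_right, ← sq] at this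
  have h := seqDiscrepancy_le_of_correlationCount_le (x := x) le_rfl hN hT hG fun u hu _ => by
    rw [correlationCount_one]
    calc _ ≤ ((S.filter fun p => ‖pairDifference x p‖ ≤ u).card : ℝ) := by gcongr
      _ ≤ S.card * (2 * u + G) := card_filter_norm_le S _ hu.le
      _ ≤ _ := by
        gcongr
        exact_mod_cast hcard
  refine h.trans_eq ?_
  have hN' : (0 : ℝ) < N := by exact_mod_cast hN
  rw [show ((Nat.factorial 1 : ℕ) : ℝ) / (T * N ^ 1) + G / T = (1 / (N : ℝ) + G) / T by
      simp; field_simp, Nat.cast_one, one_mul, mul_one, div_rpow (by positivity) hT.le,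
    sqrt_eq_rpow]
  ring

/-- `T = Q^(1/3)` is the choice that equates `T` and `(Q/T)^(1/2)`. -/
theorem one_div_sqrt_cbrt_mul {Q : ℝ} (hQ : 0 < Q) :
    1 / √(Q ^ (1 / 3 : ℝ)) * Q ^ (1 / 2 : ℝ) = Q ^ (1 / 3 : ℝ) := by
  rw [sqrt_eq_rpow, ← rpow_mul hQ.le, one_div_mul_eq_div, ← rpow_sub hQ]
  norm_num

/-- The `N` diagonal differences vanish, so the interval `{0}`, of length zero, has mass at least `N
/ N²`. -/
theorem one_div_le_differenceDiscrepancy (x : ℕ → UnitAddCircle) {N : ℕ} (hN : 1 ≤ N) :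
    1 / (N : ℝ) ≤ differenceDiscrepancy x N := by
  classical
  have hN' : (0 : ℝ) < N := by exact_mod_cast hN
  have h := (abs_le.1 (le_familyDiscrepancy (Finset.Icc 1 N ×ˢ Finset.Icc 1 N) (pairDifference x)
    (isCircleInterval_closedBall_zero 0))).2
  rw [volumeReal_closedBall _ le_rfl, mul_zero, min_eq_right zero_le_one, sub_zero] at h
  refine le_trans ?_ h
  rw [empiricalMass, Finset.card_product, Nat.card_Icc, add_tsub_cancel_right,
    div_le_div_iff₀ hN' (by positivity)]
  have : N ≤ (((Finset.Icc 1 N ×ˢ Finset.Icc 1 N).filter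
      fun p => pairDifference x p ∈ Metric.closedBall (0 : UnitAddCircle) 0).card) := by
    have hle : ((Finset.Icc 1 N).diag).card ≤ _ := Finset.card_le_card (t :=
      (Finset.Icc 1 N ×ˢ Finset.Icc 1 N).filter
        fun p => pairDifference x p ∈ Metric.closedBall (0 : UnitAddCircle) 0) (by
      rintro ⟨m, n⟩ hp
      obtain ⟨hm, hmn⟩ := Finset.mem_diag.1 hp
      obtain rfl : m = n := hmn
      simp [pairDifference, Finset.mem_Icc.1 hm])
    simpa using hle
  have : (N : ℝ) ≤ _ := Nat.cast_le.2 this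
  push_cast
  nlinarith

theorem mainTheorem5 :
    ∃ C : ℝ, 0 < C ∧
      -- the discrepancy bound at rate `α`
      (∀ (x : ℕ → UnitAddCircle) (k N : ℕ) (α T F : ℝ),
        1 ≤ k → 1 ≤ N → 0 ≤ α → α ≤ (k : ℝ) → 0 < T →
        (∀ s : ℝ, 0 < s → s < T → correlationAtRate x k N α s ≤ 2 * s + F) →
        seqDiscrepancy x N ≤
          C * (T / (N : ℝ) ^ α +
            (k : ℝ) * ((k.factorial : ℝ) / (T * (N : ℝ) ^ ((k : ℝ) - α)) + F / T) ^
              (1 / (2 * (k : ℝ))))) ∧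
      -- the case `k = 1`, `α = 0`, for the differences of distinct terms, and for every `T`
      (∀ (x : ℕ → UnitAddCircle) (N : ℕ) (T : ℝ), 2 ≤ N → 0 < T →
        seqDiscrepancy x N ≤
          C * (T + 1 / Real.sqrt T *
            (1 / (N : ℝ) + offDiagDifferenceDiscrepancy x N) ^ (1 / 2 : ℝ))) ∧
      -- the same after optimizing in `T`
      (∀ (x : ℕ → UnitAddCircle) (N : ℕ), 2 ≤ N →
        seqDiscrepancy x N ≤
          C * (1 / (N : ℝ) + offDiagDifferenceDiscrepancy x N) ^ (1 / 3 : ℝ)) ∧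
      -- Vinogradov's bound in terms of the discrepancy of the sequence of all differences
      (∀ (x : ℕ → UnitAddCircle) (N : ℕ), 1 ≤ N →
        seqDiscrepancy x N ≤ C * differenceDiscrepancy x N ^ (1 / 3 : ℝ)) := by

  -- The four bounds hold with constants `4`, `4`, `8` and `12`. In the first two, nonnegativity of
  -- the discrepancy makes the bracket nonnegative, so enlarging the constant is harmless.
  refine ⟨16, by norm_num, fun x k N α T F hk hN _ _ hT h => ?_, fun x N T hN hT => ?_,
    fun x N hN => ?_, fun x N hN => ?_⟩
  · have h1 := seqDiscrepancy_le_of_correlationAtRate_le hk hN hT h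
    have h0 : 0 ≤ seqDiscrepancy x N := familyDiscrepancy_nonneg _ _
    linarith
  · have h1 := seqDiscrepancy_le_of_offDiag_subset (x := x) (by omega : 1 ≤ N) subset_rfl
      (offDiag_subset_product _) hT
    have h0 : 0 ≤ seqDiscrepancy x N := familyDiscrepancy_nonneg _ _
    rw [offDiagDifferenceDiscrepancy]
    linarith
  · set Q := 1 / (N : ℝ) + offDiagDifferenceDiscrepancy x N with hQ
    have hQ0 : 0 < Q := add_pos_of_pos_of_nonneg (by positivity) (familyDiscrepancy_nonneg _ _)
    have h1 := seqDiscrepancy_le_of_offDiag_subset (x := x) (by omega : 1 ≤ N) subset_rfl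
      (offDiag_subset_product _) (rpow_pos_of_pos hQ0 (1 / 3))
    rw [← offDiagDifferenceDiscrepancy, ← hQ, one_div_sqrt_cbrt_mul hQ0] at h1
    linarith [rpow_pos_of_pos hQ0 (1 / 3)]
  · set Q := differenceDiscrepancy x N with hQ
    have hNQ := one_div_le_differenceDiscrepancy x hN
    have hQ0 : 0 < Q := lt_of_lt_of_le (by positivity) hNQ
    have h1 := seqDiscrepancy_le_of_offDiag_subset (x := x) hN (offDiag_subset_product _)
      subset_rfl (rpow_pos_of_pos hQ0 (1 / 3))
    rw [← differenceDiscrepancy, ← hQ] at h1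
    -- Since `1/N ≤ Q`, the sum is at most `2Q`; it is relaxed to `4Q` for a rational square root.
    have h2 : (1 / (N : ℝ) + Q) ^ (1 / 2 : ℝ) ≤ 2 * Q ^ (1 / 2 : ℝ) := by
      calc (1 / (N : ℝ) + Q) ^ (1 / 2 : ℝ) ≤ (4 * Q) ^ (1 / 2 : ℝ) := by
            gcongr
            linarith
        _ = 2 * Q ^ (1 / 2 : ℝ) := by
            rw [mul_rpow (by norm_num) hQ0.le, ← sqrt_eq_rpow,
              show (4 : ℝ) = 2 ^ 2 by norm_num, sqrt_sq (by norm_num)]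
    have h3 := mul_le_mul_of_nonneg_left h2
      (by positivity : 0 ≤ 1 / √(Q ^ (1 / 3 : ℝ)))
    rw [mul_left_comm, one_div_sqrt_cbrt_mul hQ0] at h3
    linarith [rpow_pos_of_pos hQ0 (1 / 3)]
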